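/- Let $\Gamma$ be a connected, locally finite (simple) graph with vertex set $V$ and path metric $d$. For vertices $x,y$ let $I(x,y)=\{v\in V : d(x,v)+d(v,y)=d(x,y)\}$ be the set of vertices lying on geodesics from $x$ to $y$. Say that $\Gamma$ has stable intervals if there is $\beta\ge 0$ such that for all vertices $x,y,z$ with $y,z$ adjacent, the Hausdorff distance between $I(x,y)$ and $I(x,z)$ is at most $\beta$. The combinatorial dimension of $\Gamma$ is the dimension of the injective hull $E(V,d)$ of the metric space $(V,d)$, realized as the polyhedral complex in $\mathbb{R}^V$ consisting of the pointwise minimal elements of $\{f:V\to\mathbb{R} : f(x)+f(y)\ge d(x,y)\text{ for all }x,y\in V\}$; this dimension is the supremum of the dimensions of its cells, equivalently of the convex subsets of $\mathbb{R}^V$ contained in $E(V,d)$. An action of a group $G$ on $\Gamma$ by automorphisms is elliptic if $G$ has a bounded orbit in $V$, and locally elliptic if for each $g\in G$ the cyclic subgroup $\langle g\rangle$ has a bounded orbit in $V$. Theorem. Let $\Gamma$ be a connected, locally finite graph with stable intervals and of finite combinatorial dimension, and let a finitely generated group $G$ act on $\Gamma$ by automorphisms. If the action is locally elliptic, then it is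 elliptic. In particular, if $G$ is a torsion group, then every such action of $G$ on $\Gamma$ is elliptic. -/

import Mathlib

namespace GraphAction

/-- The injective hull (tight span) of a space `X` with distance function `d`, realized inside
`ℝ^X` in the usual way: it consists of the extremal functions, that is, of the minimal elements
(for the pointwise order) of the set of all `f : X → ℝ` with `d x y ≤ f x + f y` for all
`x`, `y`. A point `p` of the hull corresponds to the function `x ↦ d (p, x)`. -/
def injectiveHull {X : Type*} (d : X → X → ℝ) : Set (X → ℝ) :=
  {f | Minimal (fun g : X → ℝ => ∀ x y, d x y ≤ g x + g y) f}

/-- The combinatorial dimension of `(X, d)`: the dimension of its injective hull as a polyhedral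
complex in `ℝ^X`. The cell of a point `f` of the hull consists of the points `g` of the hull with
`g x + g y = d x y` whenever `f x + f y = d x y`. Each finite-dimensional convex subset of the hull
lies in one cell (that of any of its relative interior points), and cells are convex when each `x`
has some `y` with `f x + f y = d x y`. So the dimension, the supremum of the dimensions of
the cells, is the supremum of the dimensions of the convex subsets `C` of the hull, the dimension
of `C` being that of its affine span. The value is `⊤` if there is no finite bound. -/
noncomputable def combinatorialDimension {X : Type*} (d : X → X → ℝ) : ℕ∞ :=
  ⨆ (C : Set (X → ℝ)) (_ : C ⊆ injectiveHull d) (_ : Convex ℝ C),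
    Cardinal.toENat (Module.rank ℝ (vectorSpan ℝ C))

variable {V : Type*}

/-- The combinatorial dimension of the vertex set of a graph with its path metric. -/
noncomputable def graphCombinatorialDimension (Γ : SimpleGraph V) : ℕ∞ :=
  combinatorialDimension (fun x y : V => (Γ.dist x y : ℝ))

/-- The interval `I(x, y)`: all vertices that lie on some geodesic from `x` to `y`
(for a connected graph). -/
def interval (Γ : SimpleGraph V) (x y : V) : Set V :=
  {v | Γ.dist x v + Γ.dist v y = Γ.dist x y}

/-- A connected graph has stable intervals if for some `β` the Hausdorff distance between the
intervals `I(x, y)` and `I(x, z)` is at most `β` for all `x` and all adjacent `y`, `z`. -/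
def HasStableIntervals (Γ : SimpleGraph V) : Prop :=
  Γ.Connected ∧ ∃ β : ℕ, ∀ x y z : V, Γ.Adj y z →
    (∀ v ∈ interval Γ x y, ∃ w ∈ interval Γ x z, Γ.dist v w ≤ β) ∧
    (∀ w ∈ interval Γ x z, ∃ v ∈ interval Γ x y, Γ.dist v w ≤ β)

/-- Every vertex has finitely many neighbours. -/
def IsLocallyFinite (Γ : SimpleGraph V) : Prop :=
  ∀ v : V, (Γ.neighborSet v).Finite

variable {G : Type*} [Group G] {Γ : SimpleGraph V}

/-- A subgroup `H` of `G` has a bounded orbit for the action `ρ` of `G` on the graph `Γ` by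
automorphisms. -/
def HasBoundedOrbit (ρ : G →* (Γ ≃g Γ)) (H : Subgroup G) : Prop :=
  ∃ x : V, ∃ R : ℕ, ∀ g ∈ H, ∀ h ∈ H, Γ.dist (ρ g x) (ρ h x) ≤ R

/-- The action is locally elliptic: each element of the group (that is, each cyclic
subgroup) has a bounded orbit. -/
def IsLocallyElliptic (ρ : G →* (Γ ≃g Γ)) : Prop :=
  ∀ g : G, HasBoundedOrbit ρ (Subgroup.zpowers g)

/-- The action is elliptic: the whole group has a bounded orbit. -/
def IsElliptic (ρ : G →* (Γ ≃g Γ)) : Prop :=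
  HasBoundedOrbit ρ ⊤

end GraphAction

/-! ### Stable intervals: distances from `v` beyond a vertex depend only on local data. -/

namespace GraphAction

open Function

variable {V : Type*} {Γ : SimpleGraph V}

/-! Let `T` be a finite symmetric generating set. Among admissible functions `f`, consider the least
`D` such that every `s ∈ T` raises `f` by at most `D`. Finite dimension makes this least value
attained and rational: a minimal such `f` lies in the injective hull, its values form boundedly many
classes modulo 1 (`exists_finset_fract`), and a rotation-number argument (`exists_rounding`) rounds
them to a common denominator `M` without increasing `D`. Hence there is an optimal integral `F` of
displacement `p` (`exists_isOptimal`).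

If `p = 0`, then `F` is invariant and `d(x, gx) ≤ 2 F x`, so orbits are bounded. If `p > 0`,
optimality yields arbitrarily long words along which `F` grows by exactly `p` at each letter
(`IsOptimal.exists_word`). By local finiteness two prefixes have the same relative distances from
`v` on a large ball, as with Cannon's cone types. Stable intervals propagate this agreement outward,
so the quotient `g` of the two prefixes satisfies `d(v, g^k a) = d(v, a) + k Δ` with `Δ > 0`, which
contradicts local ellipticity. -/

theorem dist_map_le {W : Type*} {Γ' : SimpleGraph W} (hΓ : Γ.Connected) (g : Γ →g Γ') (x y : V) :
    Γ'.dist (g x) (g y) ≤ Γ.dist x y := by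
  obtain ⟨p, hp⟩ := hΓ.exists_walk_length_eq_dist x y
  rw [← hp, ← SimpleGraph.Walk.length_map g p]
  exact SimpleGraph.dist_le _

theorem dist_apply (hΓ : Γ.Connected) (g : Γ ≃g Γ) (x y : V) :
    Γ.dist (g x) (g y) = Γ.dist x y := by
  refine le_antisymm (dist_map_le hΓ g.toHom x y) ?_
  simpa using dist_map_le hΓ g.symm.toHom (g x) (g y)

theorem dist_inv_apply (hΓ : Γ.Connected) (g : Γ ≃g Γ) (x y : V) :
    Γ.dist x (g⁻¹ y) = Γ.dist (g x) y := by
  rw [← dist_apply hΓ g, RelIso.apply_inv_self]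

theorem dist_inv_apply_left (hΓ : Γ.Connected) (g : Γ ≃g Γ) (x y : V) :
    Γ.dist (g⁻¹ x) y = Γ.dist x (g y) := by
  rw [← dist_apply hΓ g, RelIso.apply_inv_self]

theorem exists_adj_dist_eq (hΓ : Γ.Connected) {a z : V} {n : ℕ} (h : Γ.dist a z = n + 1) :
    ∃ z', Γ.Adj z' z ∧ Γ.dist a z' = n := by
  obtain ⟨p, hp⟩ := hΓ.exists_walk_length_eq_dist z a
  rw [SimpleGraph.dist_comm, h] at hp
  cases p with
  | nil => simp at hp
  | @cons _ b _ hadj q =>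
    simp only [SimpleGraph.Walk.length_cons, Nat.add_right_cancel_iff] at hp
    refine ⟨b, hadj.symm, ?_⟩
    have h1 : Γ.dist b a ≤ n := hp ▸ SimpleGraph.dist_le q
    have h2 := hΓ.dist_triangle (u := a) (v := b) (w := z)
    rw [(SimpleGraph.dist_eq_one_iff_adj).2 hadj.symm, SimpleGraph.dist_comm (u := a) (v := b)] at h2
    rw [SimpleGraph.dist_comm]
    omega

theorem finite_ball (hΓ : Γ.Connected) (hfin : IsLocallyFinite Γ) (o : V) (R : ℕ) :
    {w | Γ.dist o w ≤ R}.Finite := by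
  induction R with
  | zero =>
    refine (Set.finite_singleton o).subset fun w hw => ?_
    have : Γ.dist o w = 0 := by simpa using hw
    exact ((hΓ.dist_eq_zero_iff).1 this).symm
  | succ R ih =>
    refine (ih.union (ih.biUnion fun v _ => hfin v)).subset fun w hw => ?_
    rcases Nat.lt_or_ge R (Γ.dist o w) with h | h
    · have hw' : Γ.dist o w ≤ R + 1 := hw
      obtain ⟨z, hz, hz'⟩ := exists_adj_dist_eq hΓ (show Γ.dist o w = R + 1 by omega)
      exact Or.inr (Set.mem_biUnion (show z ∈ {w | Γ.dist o w ≤ R} from hz'.le) hz)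
    · exact Or.inl h

/-- Intervals for adjacent endpoints `y`, `z` are at Hausdorff distance at most `β`. -/
def StableWith (Γ : SimpleGraph V) (β : ℕ) : Prop :=
  ∀ x y z : V, Γ.Adj y z → ∀ v ∈ interval Γ x y, ∃ w ∈ interval Γ x z, Γ.dist v w ≤ β

/-- A vertex `a` is close to the interval from `v` to `z`, in terms of the defect
`d(v, a) + d(a, z) - d(v, z)`. -/
theorem StableWith.exists_mem_interval_near {β : ℕ} (hβ : StableWith Γ β) (hΓ : Γ.Connected)
    (v a z : V) : ∃ w ∈ interval Γ v z,
      Γ.dist a w + β * Γ.dist v z ≤ β * (Γ.dist v a + Γ.dist a z) := by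
  obtain ⟨n, hn⟩ : ∃ n, Γ.dist a z = n := ⟨_, rfl⟩
  induction n generalizing z with
  | zero =>
    obtain rfl := (hΓ.dist_eq_zero_iff).1 hn
    exact ⟨a, by simp [interval], by simp⟩
  | succ n ih =>
    obtain ⟨y, hy, hay⟩ := exists_adj_dist_eq hΓ hn
    obtain ⟨w, hw, hwa⟩ := ih y hay
    have hyz : Γ.dist y z = 1 := SimpleGraph.dist_eq_one_iff_adj.2 hy
    have hw' : Γ.dist v w + Γ.dist w y = Γ.dist v y := hw
    have h1 := hΓ.dist_triangle (u := v) (v := y) (w := z)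
    have h2 := hΓ.dist_triangle (u := w) (v := y) (w := z)
    have h3 := hΓ.dist_triangle (u := v) (v := w) (w := z)
    -- If `z` is farther from `v` than `y`, the defect is unchanged and `w` still works. Otherwise
    -- the defect grows by at least one, which pays for moving `w` by at most `β`.
    rcases Nat.lt_or_ge (Γ.dist v y) (Γ.dist v z) with h | h
    · refine ⟨w, show Γ.dist v w + Γ.dist w z = Γ.dist v z by omega, ?_⟩
      have : Γ.dist v z = Γ.dist v y + 1 := by omega
      rw [this, hn]
      rw [hay] at hwa
      linarith [hwa]
    · obtain ⟨w', hw'', hww⟩ := hβ v y z hy w hw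
      refine ⟨w', hw'', ?_⟩
      have h4 := hΓ.dist_triangle (u := a) (v := w) (w := w')
      have h5 : β * Γ.dist v z ≤ β * Γ.dist v y := Nat.mul_le_mul_left _ h
      rw [hn]
      rw [hay] at hwa
      linarith

/-- The distance to `v` near a vertex `a` determines the distance to `v` in the set of all
vertices `z` such that `a` is almost on a geodesic from `v` to `z`. -/
theorem StableWith.dist_apply_add {β K : ℕ} (hβ : StableWith Γ β) (hΓ : Γ.Connected)
    (g : Γ ≃g Γ) (v a : V)
    (hg : ∀ w, Γ.dist a w ≤ β * K + β → Γ.dist v (g w) + Γ.dist v a = Γ.dist v w + Γ.dist v (g a))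
    (z : V) (hz : Γ.dist v a + Γ.dist a z ≤ Γ.dist v z + K) :
    Γ.dist v (g z) + Γ.dist v a = Γ.dist v z + Γ.dist v (g a) := by
  have near : ∀ y, Γ.dist v a + Γ.dist a y ≤ Γ.dist v y + K →
      ∃ w ∈ interval Γ v y, Γ.dist a w ≤ β * K := fun y hy => by
    obtain ⟨w, hw, hwa⟩ := hβ.exists_mem_interval_near hΓ v a y
    have := Nat.mul_le_mul_left β hy
    exact ⟨w, hw, by rw [Nat.mul_add β _ K] at this; omega⟩
  obtain ⟨n, hn⟩ : ∃ n, Γ.dist a z = n := ⟨_, rfl⟩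
  induction n generalizing z with
  | zero =>
    obtain rfl := (hΓ.dist_eq_zero_iff).1 hn
    exact Nat.add_comm _ _
  | succ n ih =>
    obtain ⟨y, hy, hay⟩ := exists_adj_dist_eq hΓ hn
    have hyz : Γ.dist y z = 1 := SimpleGraph.dist_eq_one_iff_adj.2 hy
    have h1 := hΓ.dist_triangle (u := v) (v := y) (w := z)
    have hdy : Γ.dist v a + Γ.dist a y ≤ Γ.dist v y + K := by omega
    have hyg := ih y hdy hay
    obtain ⟨w, hw, hwa⟩ := near z hz
    obtain ⟨u, hu, hua⟩ := near y hdy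
    have hw' : Γ.dist v w + Γ.dist w z = Γ.dist v z := hw
    have hu' : Γ.dist v u + Γ.dist u y = Γ.dist v y := hu
    have hgw := hg w (by omega)
    have hgu := hg u (by omega)
    -- The path through `g w` bounds `d(v, g z)` from above. For the lower bound, stability moves `g
    -- u` to a point `g t` of the interval from `v` to `g z`; `t` is within `β * K + β` of `a`,
    -- which explains the radius in `hg`.
    have h2 := hΓ.dist_triangle (u := v) (v := g w) (w := g z)
    rw [dist_apply hΓ] at h2
    have hmem : g u ∈ interval Γ v (g y) := by
      change Γ.dist v (g u) + Γ.dist (g u) (g y) = Γ.dist v (g y)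
      rw [dist_apply hΓ]
      omega
    obtain ⟨t, ht, hut⟩ := hβ v (g y) (g z) (g.map_adj_iff.2 hy) (g u) hmem
    obtain ⟨t, rfl⟩ := g.surjective t
    rw [dist_apply hΓ] at hut
    have ht' : Γ.dist v (g t) + Γ.dist (g t) (g z) = Γ.dist v (g z) := ht
    rw [dist_apply hΓ] at ht'
    have h3 := hΓ.dist_triangle (u := a) (v := u) (w := t)
    have hgt := hg t (by omega)
    have h4 := hΓ.dist_triangle (u := v) (v := t) (w := z)
    omega

/-- If the formula holds for `k`, then `hK` says that `a` is within defect `K` of a geodesic from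
`v` to `g ^ k a`, so `dist_apply_add` applies once more. It matters that `K` does not depend on `k`.
-/
theorem StableWith.dist_pow_apply {β K Δ : ℕ} (hβ : StableWith Γ β) (hΓ : Γ.Connected)
    (g : Γ ≃g Γ) (v a : V)
    (hg : ∀ w, Γ.dist a w ≤ β * K + β → Γ.dist v (g w) + Γ.dist v a = Γ.dist v w + Γ.dist v (g a))
    (hΔ : Γ.dist v (g a) = Γ.dist v a + Δ)
    (hK : ∀ k : ℕ, Γ.dist a ((g ^ k) a) ≤ k * Δ + K) (k : ℕ) :
    Γ.dist v ((g ^ k) a) = Γ.dist v a + k * Δ := by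
  induction k with
  | zero => simp
  | succ k ih =>
    have := hβ.dist_apply_add hΓ g v a hg ((g ^ k) a) (by have := hK k; omega)
    rw [pow_succ', RelIso.mul_apply, Nat.succ_mul]
    omega

end GraphAction

/-! ### Rounding by rotation numbers. -/

namespace GraphAction

open Function

/-- In a set of reals that has finitely many points modulo `1`, each point `x` has a largest
point at most `x + D`. -/
theorem exists_greatest_le_add {X : Set ℝ} {F : Finset ℝ} (hF : ∀ x ∈ X, Int.fract x ∈ F)
    {D : ℝ} (hD : 0 ≤ D) {x : ℝ} (hx : x ∈ X) :
    ∃ y ∈ X, y ≤ x + D ∧ ∀ z ∈ X, z ≤ x + D → z ≤ y := by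
  have hfin : (X ∩ Set.Icc x (x + D)).Finite := by
    refine ((F.finite_toSet.prod (Set.finite_Icc ⌊x⌋ ⌊x + D⌋)).image
      fun t : ℝ × ℤ => t.1 + t.2).subset ?_
    rintro z ⟨hz, hxz, hzD⟩
    exact ⟨(Int.fract z, ⌊z⌋), ⟨hF z hz, Int.floor_le_floor hxz, Int.floor_le_floor hzD⟩,
      Int.fract_add_floor z⟩
  obtain ⟨y, hy, hmax⟩ := hfin.exists_maximalFor id _ ⟨x, hx, le_rfl, by linarith⟩
  refine ⟨y, hy.1, hy.2.2, fun z hz hzD => ?_⟩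
  rcases le_total x z with h | h
  · rcases le_total z y with h' | h'
    · exact h'
    · exact hmax ⟨hz, h, hzD⟩ h'
  · exact h.trans hy.2.1

/-- A set of reals with at most `m` points modulo `1`, symmetric about `0`, can be moved by
a monotone map that commutes with integer translations and with `x ↦ -x` to a set of rationals
with denominators at most `2 m`, so that any two points at distance at most `D` are moved to points
at distance at most `p / q ≤ D`. The map is `φ / (2 q)`. -/
theorem exists_rounding {X : Set ℝ} (hX : X.Nonempty) (hneg : ∀ x ∈ X, -x ∈ X)
    (hadd : ∀ x ∈ X, ∀ k : ℤ, x + k ∈ X) {F : Finset ℝ} (hF : ∀ x ∈ X, Int.fract x ∈ F)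
    {D : ℝ} (hD : 0 ≤ D) :
    ∃ q p : ℕ, 1 ≤ q ∧ q ≤ F.card ∧ (p : ℝ) ≤ q * D ∧ ∃ φ : ℝ → ℤ,
      (∀ x ∈ X, ∀ y ∈ X, x ≤ y → φ x ≤ φ y) ∧
      (∀ x ∈ X, ∀ k : ℤ, φ (x + k) = φ x + 2 * q * k) ∧
      (∀ x, φ (-x) = -φ x) ∧
      (∀ x ∈ X, ∀ y ∈ X, y ≤ x + D → φ y ≤ φ x + 2 * p) := by
  -- The map `π` acts like a lift of a monotone degree-one circle map on a finite set; its rotation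
  -- number will be `p / q`.
  choose! π hπX hπle hπmax using fun x (hx : x ∈ X) => exists_greatest_le_add hF hD hx
  have hmaps : ∀ k, ∀ x ∈ X, π^[k] x ∈ X := by
    intro k
    induction k with
    | zero => exact fun x hx => hx
    | succ k ih => exact fun x hx => by simpa using ih _ (hπX x hx)
  have hmono : ∀ x ∈ X, ∀ y ∈ X, x ≤ y → π x ≤ π y := fun x hx y hy h =>
    hπmax y hy _ (hπX x hx) ((hπle x hx).trans (by linarith))
  have htrans : ∀ x ∈ X, ∀ k : ℤ, π (x + k) = π x + k := by
    intro x hx k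
    refine le_antisymm ?_ (hπmax _ (hadd x hx k) _ (hadd _ (hπX x hx) k) (by linarith [hπle x hx]))
    have h1 := hπle _ (hadd x hx k)
    have h2 := hπmax x hx _ (hadd _ (hπX _ (hadd x hx k)) (-k)) (by push_cast; linarith)
    push_cast at h2
    linarith
  have hmonoI : ∀ k, ∀ x ∈ X, ∀ y ∈ X, x ≤ y → π^[k] x ≤ π^[k] y := by
    intro k
    induction k with
    | zero => exact fun x _ y _ h => h
    | succ k ih =>
      intro x hx y hy h
      simpa using ih _ (hπX x hx) _ (hπX y hy) (hmono x hx y hy h)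
  have htransI : ∀ k, ∀ x ∈ X, ∀ c : ℤ, π^[k] (x + c) = π^[k] x + c := by
    intro k
    induction k with
    | zero => exact fun x _ c => rfl
    | succ k ih =>
      intro x hx c
      rw [iterate_succ_apply, iterate_succ_apply, htrans x hx, ih _ (hπX x hx)]
  have hgrow : ∀ l k, k ≤ l → ∀ x ∈ X, π^[k] x ≤ π^[l] x := by
    intro l k hkl x hx
    induction l, hkl using Nat.le_induction with
    | base => exact le_rfl
    | succ l _ ih =>
      rw [iterate_succ_apply']
      exact ih.trans (hπmax _ (hmaps l x hx) _ (hmaps l x hx) (by linarith))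
  have hspeed : ∀ k, ∀ x ∈ X, π^[k] x ≤ x + k * D := by
    intro k
    induction k with
    | zero => exact fun x _ => by simp
    | succ k ih =>
      intro x hx
      rw [iterate_succ_apply]
      have h1 := ih _ (hπX x hx)
      have h2 := hπle x hx
      push_cast
      linarith
  -- Among `F.card + 1` iterates two agree modulo 1, which gives a periodic point of period at most
  -- `F.card`.
  obtain ⟨x₁, hx₁, q, p, hq, hqm, hper⟩ : ∃ x ∈ X, ∃ q p : ℕ, 1 ≤ q ∧ q ≤ F.card ∧
      π^[q] x = x + p := by
    obtain ⟨x₀, hx₀⟩ := hX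
    obtain ⟨i, hi, j, hj, hij, he⟩ := Finset.exists_ne_map_eq_of_card_lt_of_maps_to
      (s := Finset.range (F.card + 1)) (t := F) (by simp)
      (f := fun k => Int.fract (π^[k] x₀)) (fun k _ => hF _ (hmaps k x₀ hx₀))
    wlog hlt : i < j generalizing i j
    · exact this j hj i hi hij.symm he.symm (by omega)
    have hle := hgrow (j - i) 0 (Nat.zero_le _) _ (hmaps i x₀ hx₀)
    have hj' : π^[j - i] (π^[i] x₀) = π^[j] x₀ := by
      rw [← iterate_add_apply, Nat.sub_add_cancel hlt.le]
    obtain ⟨c, hc⟩ := Int.fract_eq_fract.1 he.symm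
    have hc0 : 0 ≤ c := by
      have : (0 : ℝ) ≤ c := by rw [← hc, ← hj']; simpa using hle
      exact_mod_cast this
    refine ⟨π^[i] x₀, hmaps i x₀ hx₀, j - i, c.toNat, by omega,
      by simp only [Finset.mem_range] at hj; omega, ?_⟩
    have : ((c.toNat : ℕ) : ℝ) = c := by exact_mod_cast Int.toNat_of_nonneg hc0
    rw [hj', this]
    linarith
  have hperI : ∀ t : ℕ, π^[q * t] x₁ = x₁ + (t * p : ℕ) := by
    intro t
    induction t with
    | zero => simp
    | succ t ih =>
      have := htransI q x₁ hx₁ (t * p : ℕ)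
      rw [Nat.mul_succ, Nat.add_comm, iterate_add_apply, ih]
      push_cast at this ⊢
      rw [this, hper]
      ring
  have hpD : (p : ℝ) ≤ q * D := by
    have := hspeed q x₁ hx₁
    linarith
  -- The supremum makes `φ₀ ∘ π ≤ φ₀ + p` a mere shift of the index. It is finite because comparison
  -- with the orbit of `x₁` shows that every orbit advances by `p` per `q` steps up to a bounded
  -- error.
  let φ₀ : ℝ → ℤ := fun x => ⨆ k : ℕ, ((q : ℤ) * ⌊π^[k] x⌋ - k * p)
  have hbdd : ∀ x ∈ X, BddAbove (Set.range fun k : ℕ => (q : ℤ) * ⌊π^[k] x⌋ - k * p) := by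
    intro x hx
    refine ⟨q * (⌊x₁⌋ + ⌈x - x₁⌉ + p), ?_⟩
    rintro _ ⟨k, rfl⟩
    have h1 : π^[k] x ≤ x₁ + ((k / q + 1) * p : ℕ) + ⌈x - x₁⌉ := by
      refine (hmonoI k x hx _ (hadd x₁ hx₁ ⌈x - x₁⌉) (by linarith [Int.le_ceil (x - x₁)])).trans ?_
      rw [htransI k x₁ hx₁, ← hperI]
      have : k ≤ q * (k / q + 1) := (Nat.lt_mul_div_succ k (by omega)).le
      linarith [hgrow _ _ this x₁ hx₁]
    have h2 : ⌊π^[k] x⌋ ≤ ⌊x₁⌋ + ((k / q + 1) * p : ℕ) + ⌈x - x₁⌉ := by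
      refine (Int.floor_le_floor h1).trans_eq ?_
      rw [Int.floor_add_intCast, Int.floor_add_natCast]
    have h3 : (q : ℤ) * (k / q : ℕ) ≤ k := by exact_mod_cast Nat.mul_div_le k q
    have h4 := mul_le_mul_of_nonneg_left h2 (Int.natCast_nonneg q)
    have h5 := mul_le_mul_of_nonneg_right h3 (Int.natCast_nonneg p)
    push_cast at h3 h4 h5 ⊢
    linarith
  have hφmono : ∀ x ∈ X, ∀ y ∈ X, x ≤ y → φ₀ x ≤ φ₀ y := fun x hx y hy h =>
    ciSup_mono (hbdd y hy) fun k => by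
      have := mul_le_mul_of_nonneg_left (Int.floor_le_floor (hmonoI k x hx y hy h))
        (Int.natCast_nonneg q)
      linarith
  have hφle : ∀ x ∈ X, ∀ k : ℤ, φ₀ (x + k) ≤ φ₀ x + q * k := fun x hx k =>
    ciSup_le fun i => by
      have := le_ciSup (hbdd x hx) i
      simp only [htransI i x hx, Int.floor_add_intCast]
      change _ ≤ φ₀ x at this
      linarith
  have hφadd : ∀ x ∈ X, ∀ k : ℤ, φ₀ (x + k) = φ₀ x + q * k := by
    intro x hx k
    refine le_antisymm (hφle x hx k) ?_
    have := hφle _ (hadd x hx k) (-k)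
    push_cast at this
    rw [add_neg_cancel_right] at this
    linarith
  have hφπ : ∀ x ∈ X, φ₀ (π x) ≤ φ₀ x + p := fun x hx => ciSup_le fun k => by
    have := le_ciSup (hbdd x hx) (k + 1)
    change _ ≤ φ₀ x at this
    rw [iterate_succ_apply] at this
    push_cast at this
    linarith
  have hφD : ∀ x ∈ X, ∀ y ∈ X, y ≤ x + D → φ₀ y ≤ φ₀ x + p := fun x hx y hy h =>
    (hφmono y hy _ (hπX x hx) (hπmax x hx y hy h)).trans (hφπ x hx)
  -- Antisymmetrizing makes the map odd, at the cost of a factor 2.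
  refine ⟨q, p, hq, hqm, hpD, fun x => φ₀ x - φ₀ (-x), fun x hx y hy h => ?_, fun x hx k => ?_,
    fun x => by simp, fun x hx y hy h => ?_⟩
  · have h1 := hφmono x hx y hy h
    have h2 := hφmono _ (hneg y hy) _ (hneg x hx) (by linarith)
    linarith
  · have h1 := hφadd x hx k
    have h2 := hφadd _ (hneg x hx) (-k)
    beta_reduce
    rw [show -(x + k) = -x + ((-k : ℤ) : ℝ) by push_cast; ring]
    linarith
  · have h1 := hφD x hx y hy h
    have h2 := hφD _ (hneg y hy) _ (hneg x hx) (by linarith)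
    linarith

end GraphAction

/-! ### Extremal functions and their values modulo 1. -/

namespace GraphAction

open Function

variable {V : Type*} {Γ : SimpleGraph V}

/-- `f x + f y ≥ d(x, y)` for all vertices `x`, `y`. -/
def IsAdmissible (Γ : SimpleGraph V) (f : V → ℝ) : Prop :=
  ∀ x y, (Γ.dist x y : ℝ) ≤ f x + f y

/-- The elements of `T` increase the values of `f` by at most `D`. -/
def DisplacedBy (T : Set (Γ ≃g Γ)) (D : ℝ) (f : V → ℝ) : Prop :=
  ∀ s ∈ T, ∀ x, f (s x) ≤ f x + D

theorem IsAdmissible.nonneg {f : V → ℝ} (hf : IsAdmissible Γ f) (x : V) : 0 ≤ f x := by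
  have := hf x x
  rw [SimpleGraph.dist_self] at this
  push_cast at this
  linarith

theorem mem_hull_of_approx {f : V → ℝ} (hf : IsAdmissible Γ f)
    (h : ∀ x, ∀ ε > 0, ∃ z, f x + f z ≤ Γ.dist x z + ε) :
    f ∈ injectiveHull (fun x y => (Γ.dist x y : ℝ)) := by
  refine ⟨hf, fun g hg hgf x => le_of_forall_pos_le_add fun ε hε => ?_⟩
  obtain ⟨z, hz⟩ := h x ε hε
  have h1 := hg x z
  have h2 := hgf z
  linarith

/-- Otherwise `f` could be lowered by `ε / 2` at `x` alone. Since `V` may be infinite, only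
approximate tightness is claimed. -/
theorem approx_of_mem_hull {f : V → ℝ}
    (hf : f ∈ injectiveHull (fun x y => (Γ.dist x y : ℝ))) (x : V) (ε : ℝ) (hε : 0 < ε) :
    ∃ z, f x + f z ≤ Γ.dist x z + ε := by
  classical
  by_contra! hcon
  have hadm : IsAdmissible Γ f := hf.1
  have hx := hcon x
  rw [SimpleGraph.dist_self] at hx
  push_cast at hx
  have hlow : ∀ z, f z - ε / 2 ≤ update f x (f x - ε / 2) z ∧ update f x (f x - ε / 2) z ≤ f z := by
    intro z
    rcases eq_or_ne z x with rfl | hz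
    · simp only [update_self]
      constructor <;> linarith
    · rw [update_of_ne hz]
      constructor <;> linarith
  have hg : IsAdmissible Γ (update f x (f x - ε / 2)) := by
    intro a b
    rcases eq_or_ne a x with rfl | ha
    · rw [update_self]
      linarith [hcon b, (hlow b).1]
    · rcases eq_or_ne b x with rfl | hb
      · rw [update_self, update_of_ne ha]
        have := hcon a
        rw [SimpleGraph.dist_comm] at this
        linarith
      · rw [update_of_ne ha, update_of_ne hb]
        exact hadm a b
  have := hf.2 hg (fun z => (hlow z).2) x
  rw [update_self] at this
  linarith

theorem lipschitz_of_mem_hull (hΓ : Γ.Connected) {f : V → ℝ}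
    (hf : f ∈ injectiveHull (fun x y => (Γ.dist x y : ℝ))) (x w : V) :
    f x ≤ f w + Γ.dist x w := by
  refine le_of_forall_pos_le_add fun ε hε => ?_
  obtain ⟨z, hz⟩ := approx_of_mem_hull hf x ε hε
  have h1 := hf.1 w z
  have h2 : (Γ.dist x z : ℝ) ≤ Γ.dist x w + Γ.dist w z := by exact_mod_cast hΓ.dist_triangle
  beta_reduce at h1
  linarith

/-- Zorn's lemma: both conditions pass to the pointwise infimum of a chain. Being a chain is needed
for admissibility, where two different members must be compared. -/
theorem exists_minimal_displacedBy {T : Set (Γ ≃g Γ)} {D : ℝ} {f : V → ℝ}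
    (hf : IsAdmissible Γ f) (hfD : DisplacedBy T D f) :
    ∃ y, Minimal (fun g => IsAdmissible Γ g ∧ DisplacedBy T D g) y := by
  suffices h : ∀ c ⊆ {g : (V → ℝ)ᵒᵈ | IsAdmissible Γ (OrderDual.ofDual g) ∧
      DisplacedBy T D (OrderDual.ofDual g)}, IsChain (· ≤ ·) c → ∀ y ∈ c,
      ∃ ub ∈ {g : (V → ℝ)ᵒᵈ | IsAdmissible Γ (OrderDual.ofDual g) ∧
        DisplacedBy T D (OrderDual.ofDual g)}, ∀ z ∈ c, z ≤ ub by
    obtain ⟨y, -, hy⟩ := zorn_le_nonempty₀ _ h (OrderDual.toDual f) ⟨hf, hfD⟩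
    exact ⟨OrderDual.ofDual y, hy.1, fun g hg hgy => hy.2 (y := OrderDual.toDual g) hg hgy⟩
  intro c hc hchain y₀ hy₀
  have : Nonempty c := ⟨⟨y₀, hy₀⟩⟩
  have hbdd : ∀ x, BddBelow (Set.range fun g : c => OrderDual.ofDual g.1 x) := fun x =>
    ⟨0, by rintro _ ⟨g, rfl⟩; exact (hc g.2).1.nonneg x⟩
  refine ⟨OrderDual.toDual fun x => ⨅ g : c, OrderDual.ofDual g.1 x, ⟨fun x z => ?_, fun s hs x => ?_⟩,
    fun g hg x => ciInf_le (hbdd x) ⟨g, hg⟩⟩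
  · change _ ≤ (⨅ g : c, OrderDual.ofDual g.1 x) + ⨅ g : c, OrderDual.ofDual g.1 z
    rw [← sub_le_iff_le_add]
    refine le_ciInf fun g => ?_
    rw [sub_le_comm]
    refine le_ciInf fun g' => ?_
    rcases hchain.total g.2 g'.2 with h | h
    · have h1 := (hc g'.2).1 x z
      have h2 : OrderDual.ofDual g'.1 x ≤ OrderDual.ofDual g.1 x := h x
      linarith
    · have h1 := (hc g.2).1 x z
      have h2 : OrderDual.ofDual g.1 z ≤ OrderDual.ofDual g'.1 z := h z
      linarith
  · change (⨅ g : c, OrderDual.ofDual g.1 (s x)) ≤ (⨅ g : c, OrderDual.ofDual g.1 x) + D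
    rw [← sub_le_iff_le_add]
    refine le_ciInf fun g => ?_
    rw [sub_le_iff_le_add]
    exact (ciInf_le (hbdd _) g).trans ((hc g.2).2 s hs x)

/-- A minimal element of the set of admissible functions with bounded displacement is extremal. -/
theorem exists_mem_hull_displacedBy (hΓ : Γ.Connected) {T : Set (Γ ≃g Γ)}
    (hT : ∀ s ∈ T, s⁻¹ ∈ T) {D : ℝ} {f : V → ℝ}
    (hf : IsAdmissible Γ f) (hfD : DisplacedBy T D f) :
    ∃ y ∈ injectiveHull (fun x y => (Γ.dist x y : ℝ)), DisplacedBy T D y := by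
  obtain ⟨y, ⟨hy, hyD⟩, hmin⟩ := exists_minimal_displacedBy hf hfD
  refine ⟨y, ?_, hyD⟩
  have : Nonempty V := hΓ.nonempty
  -- Averaging `y` with its conjugate `ys ≤ y` preserves admissibility and, as `T` is symmetric, the
  -- displacement bound. Minimality then forces `y = ys`, which is extremality.
  let ys : V → ℝ := fun x => ⨆ z, ((Γ.dist x z : ℝ) - y z)
  have hbdd : ∀ x, BddAbove (Set.range fun z => (Γ.dist x z : ℝ) - y z) := fun x =>
    ⟨y x, by rintro _ ⟨z, rfl⟩; linarith [hy x z]⟩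
  have hle : ∀ x, ys x ≤ y x := fun x => ciSup_le fun z => by linarith [hy x z]
  have hge : ∀ x z, (Γ.dist x z : ℝ) - y z ≤ ys x := fun x z => le_ciSup (hbdd x) z
  have hysD : DisplacedBy T D ys := fun s hs x => ciSup_le fun z => by
    have h1 := hge x (s⁻¹ z)
    have h2 := hyD _ (hT s hs) z
    rw [dist_inv_apply hΓ] at h1
    linarith
  have hgood : IsAdmissible Γ (fun x => (y x + ys x) / 2) ∧
      DisplacedBy T D (fun x => (y x + ys x) / 2) := by
    refine ⟨fun x z => ?_, fun s hs x => ?_⟩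
    · have h1 := hge x z
      have h2 := hge z x
      rw [SimpleGraph.dist_comm] at h2
      linarith
    · have h1 := hyD s hs x
      have h2 := hysD s hs x
      linarith
  have heq : ∀ x, y x ≤ ys x := fun x => by
    have := hmin hgood (fun x => by have := hle x; linarith) x
    beta_reduce at this
    linarith
  refine mem_hull_of_approx hy fun x ε hε => ?_
  obtain ⟨z, hz⟩ := exists_lt_of_lt_ciSup (show y x - ε < ys x by linarith [heq x])
  exact ⟨z, by linarith⟩

/-- Lipschitz monotone maps of `ℝ` that commute with integer translations and with `x ↦ -x`. -/
def IsEquivariantMonotone (φ : ℝ → ℝ) : Prop :=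
  (∀ x, φ (-x) = -φ x) ∧ (∀ x, ∀ k : ℕ, φ (k + x) = k + φ x) ∧
    ∀ a b, a ≤ b → φ a ≤ φ b ∧ φ b - φ a ≤ 2 * (b - a)

/-- Distances are integers, so `φ (d - b) = d - φ b`. Monotonicity then preserves `d - y z ≤ y x`,
and the Lipschitz bound preserves near-equality. -/
theorem IsEquivariantMonotone.comp_mem_hull {φ : ℝ → ℝ} (hφ : IsEquivariantMonotone φ) {y : V → ℝ}
    (hy : y ∈ injectiveHull (fun x y => (Γ.dist x y : ℝ))) :
    φ ∘ y ∈ injectiveHull (fun x y => (Γ.dist x y : ℝ)) := by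
  obtain ⟨hodd, htrans, hmono⟩ := hφ
  have key : ∀ (n : ℕ) (b : ℝ), φ (n - b) = n - φ b := fun n b => by
    rw [sub_eq_add_neg, htrans, hodd, ← sub_eq_add_neg]
  refine mem_hull_of_approx (fun x z => ?_) fun x ε hε => ?_
  · have h1 := hy.1 x z
    beta_reduce at h1
    have h2 := (hmono (Γ.dist x z - y z) (y x) (by linarith)).1
    rw [key] at h2
    simp only [comp_apply]
    linarith
  · obtain ⟨z, hz⟩ := approx_of_mem_hull hy x (ε / 2) (by linarith)
    refine ⟨z, ?_⟩
    have h1 := hy.1 x z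
    beta_reduce at h1
    have h2 := (hmono (Γ.dist x z - y z) (y x) (by linarith)).2
    rw [key] at h2
    simp only [comp_apply]
    linarith

theorem abs_sin_mul_cos_pow_sub_le (k : ℕ) (a b : ℝ) :
    |Real.sin a * Real.cos a ^ k - Real.sin b * Real.cos b ^ k| ≤ (k + 1) * |a - b| := by
  induction k with
  | zero => simpa [Real.dist_eq] using Real.lipschitzWith_sin.dist_le_mul a b
  | succ k ih =>
    have h1 : |Real.cos a - Real.cos b| ≤ |a - b| := by
      simpa [Real.dist_eq] using Real.lipschitzWith_cos.dist_le_mul a b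
    have h2 : |Real.sin b * Real.cos b ^ k| ≤ 1 := by
      rw [abs_mul, abs_pow]
      exact mul_le_one₀ (Real.abs_sin_le_one b) (by positivity)
        (pow_le_one₀ (abs_nonneg _) (Real.abs_cos_le_one b))
    have h3 : Real.sin a * Real.cos a ^ (k + 1) - Real.sin b * Real.cos b ^ (k + 1) =
        (Real.sin a * Real.cos a ^ k - Real.sin b * Real.cos b ^ k) * Real.cos a +
          (Real.sin b * Real.cos b ^ k) * (Real.cos a - Real.cos b) := by ring
    rw [h3]
    refine (abs_add_le _ _).trans ?_
    rw [abs_mul, abs_mul]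
    have h4 := mul_le_mul ih (Real.abs_cos_le_one a) (abs_nonneg _) (by positivity)
    have h5 := mul_le_mul h2 h1 (abs_nonneg _) zero_le_one
    push_cast
    linarith

/-- The constant makes the periodic perturbation 1-Lipschitz, so the sum is monotone and
2-Lipschitz. -/
theorem isEquivariantMonotone_add_sin_mul_cos_pow (k : ℕ) :
    IsEquivariantMonotone fun x => x + (2 * Real.pi * (k + 1))⁻¹ *
      (Real.sin (2 * Real.pi * x) * Real.cos (2 * Real.pi * x) ^ k) := by
  refine ⟨fun x => ?_, fun x n => ?_, fun a b hab => ?_⟩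
  · simp only [mul_neg, Real.sin_neg, Real.cos_neg]
    ring
  · have : 2 * Real.pi * (n + x) = 2 * Real.pi * x + n * (2 * Real.pi) := by ring
    simp only [this, Real.sin_add_nat_mul_two_pi, Real.cos_add_nat_mul_two_pi]
    ring
  · have hpos : 0 < 2 * Real.pi * ((k : ℝ) + 1) := by positivity
    have h := abs_sin_mul_cos_pow_sub_le k (2 * Real.pi * b) (2 * Real.pi * a)
    rw [← mul_sub, abs_of_nonneg (mul_nonneg (by positivity) (sub_nonneg.2 hab))] at h
    set B := Real.sin (2 * Real.pi * b) * Real.cos (2 * Real.pi * b) ^ k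
    set A := Real.sin (2 * Real.pi * a) * Real.cos (2 * Real.pi * a) ^ k
    have h' : |(2 * Real.pi * ((k : ℝ) + 1))⁻¹ * (B - A)| ≤ b - a := by
      rw [abs_mul, abs_of_pos (inv_pos.2 hpos), inv_mul_le_iff₀ hpos]
      linarith
    rw [mul_sub, abs_le] at h'
    constructor <;> linarith [h'.1, h'.2]

theorem not_linearIndependent_of_mem {n : ℕ} {W : Submodule ℝ (V → ℝ)}
    (hW : Cardinal.toENat (Module.rank ℝ W) ≤ n) (v : Fin (n + 1) → V → ℝ) (hv : ∀ i, v i ∈ W) :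
    ¬ LinearIndependent ℝ v := by
  intro hli
  have hli' : LinearIndependent ℝ (fun i => (⟨v i, hv i⟩ : W)) :=
    LinearIndependent.of_comp W.subtype hli
  have h1 := hli'.cardinal_lift_le_rank
  rw [Cardinal.toENat_le_natCast] at hW
  simp only [Cardinal.mk_fin, Cardinal.lift_natCast] at h1
  have h2 := h1.trans (Cardinal.lift_le.2 hW)
  rw [Cardinal.lift_natCast, Nat.cast_le] at h2
  omega

/-- In finite combinatorial dimension, the values of each extremal function are finitely many
modulo `1`, and their number is bounded. -/
theorem exists_finset_fract {n : ℕ} (hn : graphCombinatorialDimension Γ ≤ n) {y : V → ℝ}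
    (hy : y ∈ injectiveHull (fun x y => (Γ.dist x y : ℝ))) :
    ∃ F : Finset ℝ, F.card ≤ 2 * (n + 2) ∧ ∀ x, Int.fract (y x) ∈ F ∧ Int.fract (-y x) ∈ F := by
  classical
  let C : Set (V → ℝ) := {g | ∃ φ, IsEquivariantMonotone φ ∧ g = φ ∘ y}
  have hC : C ⊆ injectiveHull (fun x y => (Γ.dist x y : ℝ)) := by
    rintro _ ⟨φ, hφ, rfl⟩
    exact hφ.comp_mem_hull hy
  have hconv : Convex ℝ C := by
    rintro _ ⟨φ, hφ, rfl⟩ _ ⟨χ, hχ, rfl⟩ a b ha hb hab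
    refine ⟨fun t => a * φ t + b * χ t, ⟨fun x => ?_, fun x k => ?_, fun s t hst => ?_⟩, ?_⟩
    · simp only [hφ.1, hχ.1]
      ring
    · simp only [hφ.2.1, hχ.2.1]
      linear_combination (k : ℝ) * hab
    · have h1 := mul_le_mul_of_nonneg_left (hφ.2.2 s t hst).1 ha
      have h2 := mul_le_mul_of_nonneg_left (hχ.2.2 s t hst).1 hb
      have h3 := mul_le_mul_of_nonneg_left (hφ.2.2 s t hst).2 ha
      have h4 := mul_le_mul_of_nonneg_left (hχ.2.2 s t hst).2 hb
      refine ⟨by linarith, ?_⟩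
      have h5 : a * (2 * (t - s)) + b * (2 * (t - s)) = 2 * (t - s) := by
        linear_combination 2 * (t - s) * hab
      linarith
    · ext x
      simp
  have hrank : Cardinal.toENat (Module.rank ℝ (vectorSpan ℝ C)) ≤ n :=
    le_trans (le_iSup₂_of_le C hC (le_iSup (fun _ : Convex ℝ C =>
      Cardinal.toENat (Module.rank ℝ (vectorSpan ℝ C))) hconv)) hn
  have hyC : y ∈ C := ⟨id, ⟨fun _ => rfl, fun _ _ => rfl, fun a b h =>
    ⟨h, by simp only [id_eq]; linarith⟩⟩, rfl⟩
  -- These `n + 1` directions are dependent, so `sin * P(cos)` vanishes at all `2π y x` for some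
  -- nonzero `P` of degree at most `n`. Hence the cosine takes at most `n + 2` values, each giving
  -- at most two classes of `y x` modulo 1.
  have hv : ∀ k : Fin (n + 1), (fun x => Real.sin (2 * Real.pi * y x) *
      Real.cos (2 * Real.pi * y x) ^ (k : ℕ)) ∈ vectorSpan ℝ C := by
    intro k
    have h1 : _ ∈ C := ⟨_, isEquivariantMonotone_add_sin_mul_cos_pow k, rfl⟩
    have h2 := (vectorSpan ℝ C).smul_mem (2 * Real.pi * ((k : ℕ) + 1))
      (vsub_mem_vectorSpan ℝ h1 hyC)
    convert h2 using 1
    ext x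
    have : 2 * Real.pi * (((k : ℕ) : ℝ) + 1) ≠ 0 := by positivity
    simp only [vsub_eq_sub, Pi.smul_apply, Pi.sub_apply, comp_apply, smul_eq_mul,
      add_sub_cancel_left]
    rw [mul_inv_cancel_left₀ this]
  obtain ⟨c, hc, i, hi⟩ := Fintype.not_linearIndependent_iff.1
    (not_linearIndependent_of_mem hrank _ hv)
  let P : Polynomial ℝ := ∑ k : Fin (n + 1), Polynomial.monomial (k : ℕ) (c k)
  have hP : P ≠ 0 := fun h => hi <| by
    have := congrArg (fun Q => Polynomial.coeff Q (i : ℕ)) h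
    simpa [P, Polynomial.finsetSum_coeff, Polynomial.coeff_monomial, Fin.val_inj] using this
  have hdeg : P.natDegree ≤ n := Polynomial.natDegree_sum_le_of_forall_le _ _ fun k _ =>
    (Polynomial.natDegree_monomial_le _).trans (Nat.lt_succ_iff.1 k.2)
  have heval : ∀ x, Real.sin (2 * Real.pi * y x) * P.eval (Real.cos (2 * Real.pi * y x)) = 0 := by
    intro x
    have := congrFun hc x
    simp only [Finset.sum_apply, Pi.smul_apply, smul_eq_mul, Pi.zero_apply] at this
    rw [← this, Polynomial.eval_finsetSum, Finset.mul_sum]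
    refine Finset.sum_congr rfl fun k _ => ?_
    rw [Polynomial.eval_monomial]
    ring
  let A : Finset ℝ := insert 1 (insert (-1) P.roots.toFinset)
  have hA : A.card ≤ n + 2 := by
    have h1 : A.card ≤ _ := Finset.card_insert_le (1 : ℝ) (insert (-1) P.roots.toFinset)
    have h2 := Finset.card_insert_le (-1 : ℝ) P.roots.toFinset
    have h3 := P.roots.toFinset_card_le
    have h4 := P.card_roots'
    omega
  have hcos : ∀ x, Real.cos (2 * Real.pi * y x) ∈ A := by
    intro x
    rcases mul_eq_zero.1 (heval x) with h | h
    · rcases Real.sin_eq_zero_iff_cos_eq.1 h with h | h <;> simp [A, h]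
    · simp [A, hP, h]
  refine ⟨A.image (fun t => Int.fract (Real.arccos t / (2 * Real.pi))) ∪
    A.image (fun t => Int.fract (-(Real.arccos t / (2 * Real.pi)))), ?_, fun x => ?_⟩
  · refine (Finset.card_union_le _ _).trans ?_
    have h1 := Finset.card_image_le (s := A)
      (f := fun t => Int.fract (Real.arccos t / (2 * Real.pi)))
    have h2 := Finset.card_image_le (s := A)
      (f := fun t => Int.fract (-(Real.arccos t / (2 * Real.pi))))
    omega
  · set t := Real.cos (2 * Real.pi * y x) with ht
    have hpi : 2 * Real.pi ≠ 0 := by positivity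
    obtain ⟨k, hk⟩ := Real.cos_eq_cos_iff.1
      ((Real.cos_arccos (Real.neg_one_le_cos _) (Real.cos_le_one _)).trans ht)
    have hk' : y x = Real.arccos t / (2 * Real.pi) + k ∨
        y x = -(Real.arccos t / (2 * Real.pi)) + k := by
      rcases hk with hk | hk
      · left
        field_simp
        linarith
      · right
        field_simp
        linarith
    simp only [Finset.mem_union, Finset.mem_image]
    rcases hk' with h | h
    · exact ⟨Or.inl ⟨t, hcos x, by rw [h, Int.fract_add_intCast]⟩, Or.inr ⟨t, hcos x, by
        rw [h, neg_add, ← Int.cast_neg, Int.fract_add_intCast]⟩⟩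
    · exact ⟨Or.inr ⟨t, hcos x, by rw [h, Int.fract_add_intCast]⟩, Or.inl ⟨t, hcos x, by
        rw [h, neg_add, neg_neg, ← Int.cast_neg, Int.fract_add_intCast]⟩⟩

end GraphAction

/-! ### Optimal displacement and long words. -/

namespace GraphAction

open Function

variable {V : Type*} {Γ : SimpleGraph V}

/-- In finite combinatorial dimension, an admissible function can be replaced by one with values
in `(1/M) ℤ`, where `M` depends only on the dimension, without increasing the displacement. Here
`F` is `M` times this function. -/
theorem exists_rational_displacedBy (hΓ : Γ.Connected) {T : Set (Γ ≃g Γ)}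
    (hT : ∀ s ∈ T, s⁻¹ ∈ T) {n : ℕ} (hn : graphCombinatorialDimension Γ ≤ n)
    {D : ℝ} (hD : 0 ≤ D) {f : V → ℝ} (hf : IsAdmissible Γ f) (hfD : DisplacedBy T D f) :
    ∃ (p : ℕ) (F : V → ℤ), (p : ℝ) ≤ (2 * (2 * (n + 2)).factorial : ℕ) * D ∧
      (∀ x y, (2 * (2 * (n + 2)).factorial : ℕ) * (Γ.dist x y : ℤ) ≤ F x + F y) ∧
      (∀ x y, F x ≤ F y + (2 * (2 * (n + 2)).factorial : ℕ) * (Γ.dist x y : ℤ)) ∧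
      ∀ s ∈ T, ∀ x, F (s x) ≤ F x + p := by
  obtain ⟨y, hy, hyD⟩ := exists_mem_hull_displacedBy hΓ hT hf hfD
  obtain ⟨A, hA, hyA⟩ := exists_finset_fract hn hy
  let X : Set ℝ := {t | ∃ x, ∃ k : ℤ, t = y x + k ∨ t = -y x + k}
  have hyX : ∀ x, y x ∈ X := fun x => ⟨x, 0, Or.inl (by simp)⟩
  have hyX' : ∀ x, -y x ∈ X := fun x => ⟨x, 0, Or.inr (by simp)⟩
  have hadd : ∀ t ∈ X, ∀ k : ℤ, t + k ∈ X := by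
    rintro t ⟨x, l, rfl | rfl⟩ k
    · exact ⟨x, l + k, Or.inl (by push_cast; ring)⟩
    · exact ⟨x, l + k, Or.inr (by push_cast; ring)⟩
  obtain ⟨o⟩ := hΓ.nonempty
  obtain ⟨q, p, hq, hqA, hpD, φ, hmono, htrans, hodd, hdisp⟩ := exists_rounding (X := X)
    ⟨_, hyX o⟩
    (by
      rintro t ⟨x, l, rfl | rfl⟩
      · exact ⟨x, -l, Or.inr (by push_cast; ring)⟩
      · exact ⟨x, -l, Or.inl (by push_cast; ring)⟩)
    hadd (F := A)
    (by
      rintro t ⟨x, l, rfl | rfl⟩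
      · rw [Int.fract_add_intCast]; exact (hyA x).1
      · rw [Int.fract_add_intCast]; exact (hyA x).2) hD
  -- The denominator `2 * q` depends on `y`; the factorial makes it uniform.
  obtain ⟨r, hr⟩ : q ∣ (2 * (n + 2)).factorial := Nat.dvd_factorial hq (hqA.trans hA)
  have hlip : ∀ x w, φ (y x) ≤ φ (y w) + 2 * q * (Γ.dist x w : ℤ) := fun x w => by
    rw [← htrans _ (hyX w)]
    exact hmono _ (hyX x) _ (hadd _ (hyX w) _)
      (by push_cast; exact lipschitz_of_mem_hull hΓ hy x w)
  have hadm : ∀ x z, 2 * q * (Γ.dist x z : ℤ) ≤ φ (y x) + φ (y z) := fun x z => by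
    have h1 := hy.1 x z
    beta_reduce at h1
    have h2 := hmono _ (hadd _ (hyX' z) (Γ.dist x z)) _ (hyX x) (by push_cast; linarith)
    rw [htrans _ (hyX' z), hodd] at h2
    linarith
  have hr0 : (0 : ℤ) ≤ r := Int.natCast_nonneg r
  refine ⟨2 * p * r, fun x => r * φ (y x), ?_, fun x z => ?_, fun x z => ?_, fun s hs x => ?_⟩
  · rw [hr]
    have := mul_le_mul_of_nonneg_left hpD (show (0 : ℝ) ≤ 2 * r by positivity)
    push_cast
    linarith
  · rw [hr]
    have := mul_le_mul_of_nonneg_left (hadm x z) hr0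
    push_cast
    linarith
  · rw [hr]
    have := mul_le_mul_of_nonneg_left (hlip x z) hr0
    push_cast
    linarith
  · have := mul_le_mul_of_nonneg_left (hdisp _ (hyX x) _ (hyX (s x)) (hyD s hs x)) hr0
    push_cast
    linarith

/-- `F / M` is an admissible function of displacement `p / M`, and this is the least possible
displacement. -/
structure IsOptimal (T : Set (Γ ≃g Γ)) (M p : ℕ) (F : V → ℤ) : Prop where
  pos : 0 < M
  le_add : ∀ x y, M * (Γ.dist x y : ℤ) ≤ F x + F y
  lipschitz : ∀ x y, F x ≤ F y + M * (Γ.dist x y : ℤ)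
  displaced : ∀ s ∈ T, ∀ x, F (s x) ≤ F x + p
  le_of_displacedBy : ∀ D : ℝ, 0 ≤ D → ∀ f, IsAdmissible Γ f → DisplacedBy T D f → (p : ℝ) ≤ M * D

/-- With a fixed denominator the possible displacements are natural numbers, so a least one exists.
Distance from a base point shows that there is one. -/
theorem exists_isOptimal (hΓ : Γ.Connected) {T : Set (Γ ≃g Γ)} (hTfin : T.Finite)
    (hT : ∀ s ∈ T, s⁻¹ ∈ T) (hdim : graphCombinatorialDimension Γ < ⊤) :
    ∃ M p F, IsOptimal (Γ := Γ) T M p F := by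
  classical
  obtain ⟨n, hn⟩ := ENat.ne_top_iff_exists.1 hdim.ne
  obtain ⟨o⟩ := hΓ.nonempty
  obtain ⟨D, hD⟩ := (hTfin.image fun s => Γ.dist o (s o)).bddAbove
  have hadm : IsAdmissible Γ fun x => (Γ.dist o x : ℝ) := fun x y => by
    have := hΓ.dist_triangle (u := x) (v := o) (w := y)
    rw [SimpleGraph.dist_comm (u := x) (v := o)] at this
    beta_reduce
    exact_mod_cast this
  have hdisp : DisplacedBy T D fun x => (Γ.dist o x : ℝ) := fun s hs x => by
    have h1 := hΓ.dist_triangle (u := o) (v := s o) (w := s x)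
    rw [dist_apply hΓ] at h1
    have h2 : Γ.dist o (s o) ≤ D := hD ⟨s, hs, rfl⟩
    have : Γ.dist o (s x) ≤ Γ.dist o x + D := by omega
    beta_reduce
    exact_mod_cast this
  have key := fun (D : ℝ) (hD : 0 ≤ D) (f : V → ℝ) (hf : IsAdmissible Γ f)
    (hfD : DisplacedBy T D f) => exists_rational_displacedBy hΓ hT hn.ge hD hf hfD
  set M := 2 * (2 * (n + 2)).factorial
  have hex : ∃ p : ℕ, ∃ F : V → ℤ, (∀ x y, M * (Γ.dist x y : ℤ) ≤ F x + F y) ∧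
      (∀ x y, F x ≤ F y + M * (Γ.dist x y : ℤ)) ∧ ∀ s ∈ T, ∀ x, F (s x) ≤ F x + p := by
    obtain ⟨p, F, -, h⟩ := key D (Nat.cast_nonneg D) _ hadm hdisp
    exact ⟨p, F, h⟩
  obtain ⟨F, h1, h2, h3⟩ := Nat.find_spec hex
  refine ⟨M, Nat.find hex, F, by positivity, h1, h2, h3, fun D hD f hf hfD => ?_⟩
  obtain ⟨p, F, hp, h⟩ := key D hD f hf hfD
  exact (Nat.cast_le.2 (Nat.find_min' hex ⟨F, h⟩)).trans hp

/-- The products `w (n - 1) * ⋯ * w 0`. -/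
def partialProd {G : Type*} [Group G] (w : ℕ → G) : ℕ → G
  | 0 => 1
  | n + 1 => w n * partialProd w n

theorem partialProd_mem {G : Type*} [Group G] {H : Subgroup G} {w : ℕ → G} (hw : ∀ i, w i ∈ H)
    (n : ℕ) : partialProd w n ∈ H := by
  induction n with
  | zero => exact H.one_mem
  | succ n ih => exact H.mul_mem (hw n) ih

theorem exists_partialProd_succ {G : Type*} [Group G] {T : Set G} {w : ℕ → G} (hw : ∀ i, w i ∈ T)
    {s : G} (hs : s ∈ T) :
    ∃ w' : ℕ → G, (∀ i, w' i ∈ T) ∧ ∀ k, partialProd w' (k + 1) = partialProd w k * s := by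
  refine ⟨fun i => Nat.casesOn i s w, fun i => by cases i <;> simp [hs, hw], fun k => ?_⟩
  induction k with
  | zero => simp [partialProd]
  | succ k ih => rw [partialProd, ih, partialProd, mul_assoc]

variable {T : Set (Γ ≃g Γ)} {M p : ℕ} {F : V → ℤ}

theorem IsOptimal.nonneg (h : IsOptimal T M p F) (x : V) : 0 ≤ F x := by
  have := h.le_add x x
  simp only [SimpleGraph.dist_self, Nat.cast_zero, mul_zero] at this
  omega

theorem IsOptimal.partialProd_add_le (h : IsOptimal T M p F) {w : ℕ → (Γ ≃g Γ)}
    (hw : ∀ i, w i ∈ T) (i t : ℕ) (x : V) :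
    F (partialProd w (i + t) x) ≤ F (partialProd w i x) + t * p := by
  induction t with
  | zero => simp
  | succ t ih =>
    have := h.displaced _ (hw (i + t)) (partialProd w (i + t) x)
    rw [← Nat.add_assoc, partialProd, RelIso.mul_apply]
    push_cast
    linarith

theorem IsOptimal.le_partialProd_add (h : IsOptimal T M p F) (hT : ∀ s ∈ T, s⁻¹ ∈ T)
    {w : ℕ → (Γ ≃g Γ)} (hw : ∀ i, w i ∈ T) (i t : ℕ) (x : V) :
    F (partialProd w i x) ≤ F (partialProd w (i + t) x) + t * p := by
  induction t with
  | zero => simp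
  | succ t ih =>
    have := h.displaced _ (hT _ (hw (i + t))) (w (i + t) (partialProd w (i + t) x))
    rw [RelIso.inv_apply_self] at this
    rw [← Nat.add_assoc, partialProd, RelIso.mul_apply]
    push_cast
    linarith

/-- The least displacement is attained along arbitrarily long words, on the whole word. -/
theorem IsOptimal.exists_word (h : IsOptimal T M p F) (hΓ : Γ.Connected) (hone : 1 ∈ T)
    (hp : 0 < p) (n : ℕ) :
    ∃ w : ℕ → (Γ ≃g Γ), (∀ i, w i ∈ T) ∧ ∃ v, ∀ i ≤ n, F (partialProd w i v) = F v + i * p := by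
  suffices hex : ∃ w : ℕ → (Γ ≃g Γ), (∀ i, w i ∈ T) ∧ ∃ v, F v + n * p ≤ F (partialProd w n v) by
    obtain ⟨w, hw, v, hv⟩ := hex
    refine ⟨w, hw, v, fun i hi => le_antisymm ?_ ?_⟩
    · simpa [partialProd] using h.partialProd_add_le hw 0 i v
    · have := h.partialProd_add_le hw i (n - i) v
      rw [Nat.add_sub_cancel' hi] at this
      push_cast [hi] at this
      linarith
  obtain ⟨o⟩ := hΓ.nonempty
  rcases Nat.eq_zero_or_pos n with rfl | hn
  · exact ⟨fun _ => 1, fun _ => hone, o, by simp [partialProd]⟩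
  by_contra! hcon
  have hn' : (0 : ℝ) < n := by exact_mod_cast hn
  have hM : (0 : ℝ) < M := by exact_mod_cast h.pos
  -- Here `c = p - 1 / n`. If no word of length `n` gains `n * p`, integrality bounds every gain by
  -- `n * p - 1 = c * n`, and the supremum of `Φ` over shorter words has displacement at most `c <
  -- p` before division by `M`, contradicting optimality.
  obtain ⟨c, hc⟩ : ∃ c : ℝ, c = ((n : ℝ) * p - 1) / n := ⟨_, rfl⟩
  have hcn : c * n = n * p - 1 := by rw [hc]; field_simp
  have hc0 : 0 ≤ c := by
    have : (1 : ℝ) ≤ n * p := by exact_mod_cast Nat.mul_pos hn hp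
    rw [hc]
    exact div_nonneg (by linarith) hn'.le
  have hcp : c < p := by
    have : c * n < p * n := by linarith
    exact lt_of_mul_lt_mul_right this hn'.le
  let W := {w : ℕ → (Γ ≃g Γ) // ∀ i, w i ∈ T}
  let Φ : V → W × Fin n → ℝ := fun v a => F (partialProd a.1.1 a.2 v) - c * (a.2 : ℕ)
  have hbdd : ∀ v, BddAbove (Set.range (Φ v)) := fun v => ⟨F v + n * p, by
    rintro _ ⟨⟨w, k⟩, rfl⟩
    have h1 := h.partialProd_add_le w.2 0 k v
    rw [Nat.zero_add] at h1
    have h2 : (F (partialProd w.1 k v) : ℝ) ≤ F v + (k : ℕ) * p := by exact_mod_cast h1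
    have h3 : ((k : ℕ) : ℝ) * p ≤ n * p := by
      exact_mod_cast Nat.mul_le_mul_right p k.2.le
    have h4 : 0 ≤ c * (k : ℕ) := by positivity
    change (F (partialProd w.1 k v) : ℝ) - c * (k : ℕ) ≤ _
    linarith⟩
  have hle : ∀ v a, Φ v a ≤ ⨆ a, Φ v a := fun v a => le_ciSup (hbdd v) a
  let w₁ : W × Fin n := (⟨fun _ => 1, fun _ => hone⟩, ⟨0, hn⟩)
  have hF : ∀ v, (F v : ℝ) ≤ ⨆ a, Φ v a := fun v => by
    simpa [Φ, w₁, partialProd] using hle v w₁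
  have hadm : IsAdmissible Γ fun v => (⨆ a, Φ v a) / M := fun x y => by
    have h1 : (M : ℝ) * Γ.dist x y ≤ F x + F y := by exact_mod_cast h.le_add x y
    rw [← add_div, le_div_iff₀ hM]
    linarith [hF x, hF y]
  have hdisp : DisplacedBy T (c / M) fun v => (⨆ a, Φ v a) / M := fun s hs v => by
    rw [← add_div]
    refine div_le_div_of_nonneg_right ?_ hM.le
    have : Nonempty (W × Fin n) := ⟨w₁⟩
    refine ciSup_le ?_
    rintro ⟨⟨w, hw⟩, k⟩
    obtain ⟨w', hw', hww⟩ := exists_partialProd_succ hw hs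
    change (F (partialProd w k (s v)) : ℝ) - c * (k : ℕ) ≤ _
    rw [← RelIso.mul_apply, ← hww]
    rcases Nat.lt_or_ge ((k : ℕ) + 1) n with hk | hk
    · have : (F (partialProd w' ((k : ℕ) + 1) v) : ℝ) - c * ((k : ℕ) + 1 : ℕ) ≤ _ :=
        hle v (⟨w', hw'⟩, ⟨k + 1, hk⟩)
      push_cast at this
      linarith
    · have hkn : (k : ℕ) + 1 = n := le_antisymm k.2 hk
      have h1 := hcon w' hw' v
      have h2 : (F (partialProd w' n v) : ℝ) + 1 ≤ F v + n * p := by exact_mod_cast h1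
      have h3 : c * ((k : ℕ) + 1) = c * n := by
        congr 1
        exact_mod_cast hkn
      rw [hkn]
      linarith [hF v]
  have := h.le_of_displacedBy _ (div_nonneg hc0 hM.le) _ hadm hdisp
  rw [mul_div_cancel₀ _ hM.ne'] at this
  linarith

/-- If the least displacement is positive, then some element of the group generated by `T` has
positive translation length. -/
theorem IsOptimal.exists_hyperbolic (h : IsOptimal T M p F) (hΓ : Γ.Connected)
    (hfin : IsLocallyFinite Γ) {β : ℕ} (hβ : StableWith Γ β)
    (hT : ∀ s ∈ T, s⁻¹ ∈ T) (hone : 1 ∈ T) (hp : 0 < p) :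
    ∃ g ∈ Subgroup.closure T, ∃ v a, ∃ Δ > 0, ∀ k : ℕ,
      Γ.dist v ((g ^ k) a) = Γ.dist v a + k * Δ := by
  classical
  obtain ⟨o⟩ := hΓ.nonempty
  -- This is the additive error in comparing distances from `a` with growth of `F`; it fixes the
  -- radius `R` needed for propagation.
  set K := 2 * (F o).toNat with hKdef
  have hK : (K : ℤ) = 2 * F o := by
    rw [hKdef, Nat.cast_mul, Int.toNat_of_nonneg (h.nonneg o)]
    rfl
  set R := β * K + β
  have : Finite {w | Γ.dist o w ≤ R} := finite_ball hΓ hfin o R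
  have hE : ((Set.univ.pi fun _ : {w | Γ.dist o w ≤ R} => Set.Icc (-R : ℤ) R) ×ˢ
      Set.Icc (-F o) (F o)).Finite :=
    (Set.Finite.pi fun _ => Set.finite_Icc _ _).prod (Set.finite_Icc _ _)
  obtain ⟨w, hw, v, hv⟩ := h.exists_word hΓ hone hp hE.toFinset.card
  let γ := partialProd w
  -- The recorded data are the relative distances from `v` on the ball around `γ i⁻¹ o`, and the gap
  -- between `F` and `M * d` at `γ i v`. Equality of the gaps turns growth of `F` into growth of
  -- distance: `M * (Δ + 1) = (j - i) * p`.
  obtain ⟨i, hi, j, hj, hij, he⟩ := Finset.exists_ne_map_eq_of_card_lt_of_maps_to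
    (s := Finset.range (hE.toFinset.card + 1)) (t := hE.toFinset) (by simp)
    (f := fun i => (fun x => (Γ.dist v ((γ i)⁻¹ x) : ℤ) - Γ.dist v ((γ i)⁻¹ o),
      F (γ i v) - M * (Γ.dist v ((γ i)⁻¹ o) : ℤ))) (fun i _ => by
        rw [Finset.mem_coe, Set.Finite.mem_toFinset]
        refine ⟨fun x _ => ?_, ?_⟩
        · have h1 := hΓ.dist_triangle (u := v) (v := (γ i)⁻¹ o) (w := (γ i)⁻¹ x)
          have h2 := hΓ.dist_triangle (u := v) (v := (γ i)⁻¹ x) (w := (γ i)⁻¹ o)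
          rw [dist_apply hΓ] at h1 h2
          have h3 : Γ.dist o x ≤ R := x.2
          rw [SimpleGraph.dist_comm (u := (x : V))] at h2
          constructor <;> simp only <;> omega
        · have h1 := h.le_add (γ i v) o
          have h2 := h.lipschitz (γ i v) o
          rw [← dist_inv_apply hΓ] at h1 h2
          constructor <;> simp only <;> linarith)
  wlog hlt : i < j generalizing i j
  · exact this j hj i hi hij.symm he.symm (by omega)
  rw [Finset.mem_range] at hj
  obtain ⟨he₁, he₂⟩ := Prod.ext_iff.1 he
  have hvi := hv i (by omega)
  have hvj := hv j (by omega)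
  change F (γ i v) = _ at hvi
  change F (γ j v) = _ at hvj
  simp only [hvi, hvj] at he₂
  have hMpos : (0 : ℤ) < M := by exact_mod_cast h.pos
  have hppos : (0 : ℤ) < p := by exact_mod_cast hp
  have hltZ : (i : ℤ) < j := by exact_mod_cast hlt
  have hΔ : Γ.dist v ((γ i)⁻¹ o) < Γ.dist v ((γ j)⁻¹ o) := by
    have h1 := mul_lt_mul_of_pos_right hltZ hppos
    have h2 : (M : ℤ) * Γ.dist v ((γ i)⁻¹ o) < M * Γ.dist v ((γ j)⁻¹ o) := by linarith
    exact_mod_cast lt_of_mul_lt_mul_left h2 hMpos.le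
  obtain ⟨Δ, hΔ'⟩ := Nat.exists_eq_add_of_lt hΔ
  have hMΔ : (M : ℤ) * (Δ + 1 : ℕ) = (j - i : ℕ) * p := by
    rw [hΔ'] at he₂
    push_cast [hlt.le] at he₂ ⊢
    linarith
  have hmem : ∀ k, γ k ∈ Subgroup.closure T :=
    partialProd_mem fun i => Subgroup.subset_closure (hw i)
  have hga : ((γ j)⁻¹ * γ i) ((γ i)⁻¹ o) = (γ j)⁻¹ o := by
    rw [RelIso.mul_apply, RelIso.apply_inv_self]
  refine ⟨(γ j)⁻¹ * γ i, mul_mem (inv_mem (hmem j)) (hmem i), v, (γ i)⁻¹ o, Δ + 1, by omega,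
    hβ.dist_pow_apply (K := K) hΓ _ _ _ (fun x hx => ?_) ?_ fun k => ?_⟩
  · rw [← dist_apply hΓ (γ i), RelIso.apply_inv_self] at hx
    have := congrFun he₁ ⟨γ i x, hx⟩
    simp only [RelIso.inv_apply_self] at this
    rw [hga, RelIso.mul_apply]
    omega
  · rw [hga]
    omega
  -- Applying `g` raises `F ∘ γ i` by at most `(j - i) * p`, which equals `M` times the translation
  -- length sought. Admissibility of `F` then gives the upper bound on `d(a, g^k a)`.
  · have hFk : F (γ i ((((γ j)⁻¹ * γ i) ^ k) ((γ i)⁻¹ o))) ≤ F o + k * ((j - i : ℕ) * p) := by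
      induction k with
      | zero => simp
      | succ k ih =>
        have := h.le_partialProd_add hT hw i (j - i) ((γ j)⁻¹ (γ i
          ((((γ j)⁻¹ * γ i) ^ k) ((γ i)⁻¹ o))))
        rw [Nat.add_sub_cancel' hlt.le] at this
        change F (γ i _) ≤ F (γ j _) + _ at this
        rw [RelIso.apply_inv_self] at this
        rw [pow_succ', RelIso.mul_apply, RelIso.mul_apply]
        push_cast at this ih ⊢
        linarith
    have h1 := h.le_add o (γ i ((((γ j)⁻¹ * γ i) ^ k) ((γ i)⁻¹ o)))
    rw [← dist_inv_apply_left hΓ] at h1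
    rw [← hMΔ] at hFk
    have h2 : (M : ℤ) * Γ.dist ((γ i)⁻¹ o) ((((γ j)⁻¹ * γ i) ^ k) ((γ i)⁻¹ o)) ≤
        M * (k * (Δ + 1 : ℕ) + K : ℕ) := by
      have h3 : (K : ℤ) ≤ M * K := le_mul_of_one_le_left (by omega) (by omega)
      push_cast at h1 hFk h3 ⊢
      linarith
    exact_mod_cast le_of_mul_le_mul_left h2 hMpos

theorem IsOptimal.dist_le (h : IsOptimal T M 0 F) (hT : ∀ s ∈ T, s⁻¹ ∈ T) {g : Γ ≃g Γ}
    (hg : g ∈ Subgroup.closure T) (x : V) : (Γ.dist x (g x) : ℤ) ≤ 2 * F x := by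
  have hle : ∀ s ∈ T, ∀ x, F (s x) ≤ F x := fun s hs x => by simpa using h.displaced s hs x
  have hinv : ∀ x, F (g x) = F x := by
    induction hg using Subgroup.closure_induction with
    | mem s hs =>
      refine fun x => le_antisymm (hle s hs x) ?_
      simpa using hle _ (hT s hs) (s x)
    | one => exact fun x => rfl
    | mul a b _ _ ha hb => exact fun x => by rw [RelIso.mul_apply, ha, hb]
    | inv a _ ha => exact fun x => by rw [← ha (a⁻¹ x), RelIso.apply_inv_self]
  have h1 := h.le_add x (g x)
  have h2 : (1 : ℤ) * Γ.dist x (g x) ≤ M * Γ.dist x (g x) :=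
    mul_le_mul_of_nonneg_right (by exact_mod_cast h.pos) (by positivity)
  rw [hinv] at h1
  linarith

end GraphAction

/-! ### From optimal functions to group actions. -/

namespace GraphAction

variable {V : Type*} {Γ : SimpleGraph V} {G : Type*} [Group G]

theorem not_hasBoundedOrbit_zpowers (hΓ : Γ.Connected) (ρ : G →* (Γ ≃g Γ)) {g : G} {v a : V}
    {Δ : ℕ} (hΔ : 0 < Δ) (h : ∀ k : ℕ, Γ.dist v ((ρ g ^ k) a) = Γ.dist v a + k * Δ) :
    ¬ HasBoundedOrbit ρ (Subgroup.zpowers g) := by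
  rintro ⟨x, R, hR⟩
  obtain ⟨N, hN⟩ : ∃ N, N = 2 * Γ.dist v a + 2 * Γ.dist a x + R + 1 := ⟨_, rfl⟩
  have h1 := hR 1 (one_mem _) (g ^ N) (Subgroup.npow_mem_zpowers g N)
  rw [map_one, RelIso.one_apply, map_pow] at h1
  have h2 := hΓ.dist_triangle (u := v) (v := a) (w := (ρ g ^ N) a)
  have h3 := hΓ.dist_triangle (u := a) (v := x) (w := (ρ g ^ N) a)
  have h4 := hΓ.dist_triangle (u := x) (v := (ρ g ^ N) x) (w := (ρ g ^ N) a)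
  rw [dist_apply hΓ, SimpleGraph.dist_comm (u := x) (v := a)] at h4
  have h5 := h N
  have h6 : N ≤ N * Δ := Nat.le_mul_of_pos_right N hΔ
  omega

theorem isLocallyElliptic_of_isMulTorsion (hΓ : Γ.Connected) (hG : IsMulTorsion G)
    (ρ : G →* (Γ ≃g Γ)) : IsLocallyElliptic ρ := by
  intro g
  obtain ⟨o⟩ := hΓ.nonempty
  have hfin : (Subgroup.zpowers g : Set G).Finite := finite_zpowers.2 (hG g)
  obtain ⟨R, hR⟩ := ((hfin.prod hfin).image fun t => Γ.dist (ρ t.1 o) (ρ t.2 o)).bddAbove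
  exact ⟨o, R, fun a ha b hb => hR ⟨(a, b), ⟨ha, hb⟩, rfl⟩⟩

theorem isElliptic_of_isLocallyElliptic (hfin : IsLocallyFinite Γ) (hstable : HasStableIntervals Γ)
    (hdim : graphCombinatorialDimension Γ < ⊤) (hG : Group.FG G) (ρ : G →* (Γ ≃g Γ))
    (hρ : IsLocallyElliptic ρ) : IsElliptic ρ := by
  obtain ⟨hΓ, β, hβ⟩ := hstable
  have hβ' : StableWith Γ β := fun x y z hyz => (hβ x y z hyz).1
  obtain ⟨S, hS⟩ := hG.out
  let U : Set G := insert 1 (S ∪ (S : Set G)⁻¹)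
  have hUfin : U.Finite := (S.finite_toSet.union S.finite_toSet.inv).insert 1
  have hU : ∀ s ∈ U, s⁻¹ ∈ U := by
    rintro s (rfl | hs | hs)
    · exact Or.inl inv_one
    · exact Or.inr (Or.inr (by simpa using hs))
    · exact Or.inr (Or.inl hs)
  have hUtop : Subgroup.closure U = ⊤ :=
    top_le_iff.1 (hS ▸ Subgroup.closure_mono fun s hs => Or.inr (Or.inl hs))
  have hclosure : Subgroup.closure (ρ '' U) = ρ.range := by
    rw [← MonoidHom.map_closure, hUtop, MonoidHom.range_eq_map]
  have hT : ∀ s ∈ ρ '' U, s⁻¹ ∈ ρ '' U := by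
    rintro _ ⟨s, hs, rfl⟩
    exact ⟨s⁻¹, hU s hs, map_inv ρ s⟩
  obtain ⟨M, p, F, hF⟩ := exists_isOptimal hΓ (hUfin.image ρ) hT hdim
  rcases Nat.eq_zero_or_pos p with rfl | hp
  · obtain ⟨o⟩ := hΓ.nonempty
    refine ⟨o, (2 * F o).toNat, fun g _ h _ => ?_⟩
    have := hF.dist_le hT (g := ρ (g⁻¹ * h)) (hclosure ▸ ⟨_, rfl⟩) o
    rw [map_mul, map_inv, RelIso.mul_apply, dist_inv_apply hΓ] at this
    omega
  · obtain ⟨g, hg, v, a, Δ, hΔ, h⟩ :=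
      hF.exists_hyperbolic hΓ hfin hβ' hT ⟨1, Or.inl rfl, map_one ρ⟩ hp
    rw [hclosure] at hg
    obtain ⟨g, rfl⟩ := hg
    exact (not_hasBoundedOrbit_zpowers hΓ ρ hΔ h (hρ g)).elim

end GraphAction

theorem mainTheorem2 {V : Type*} (Γ : SimpleGraph V)
    (hfin : GraphAction.IsLocallyFinite Γ)
    (hstable : GraphAction.HasStableIntervals Γ)
    (hdim : GraphAction.graphCombinatorialDimension Γ < ⊤)
    {G : Type*} [Group G] (hG : Group.FG G) (ρ : G →* (Γ ≃g Γ)) :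
    (GraphAction.IsLocallyElliptic ρ → GraphAction.IsElliptic ρ) ∧
      (IsMulTorsion G → GraphAction.IsElliptic ρ) :=
  ⟨GraphAction.isElliptic_of_isLocallyElliptic hfin hstable hdim hG ρ, fun h =>
    GraphAction.isElliptic_of_isLocallyElliptic hfin hstable hdim hG ρ
      (GraphAction.isLocallyElliptic_of_isMulTorsion hstable.1 h ρ)⟩
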